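/- Let $n\in\mathbb N$, let $1\le k\le\infty$, and let $H:\mathbb R^{2n}\to\mathbb R$ be of class $C^{k+1}$. Write $z=(q,p)$ for the points of $\mathbb R^{2n}$, let $J=\begin{pmatrix}0&-I_n\\ I_n&0\end{pmatrix}$, and let $\phi_h$ be the exact time-$h$ flow map of the Hamiltonian system $\dot z=J^{-1}\nabla H(z)$ (defined at those $z$ from which the solution exists up to time $h$). On $\mathbb R^{2n}\times\mathbb R^{2n}$, with points $(z,\bar z)=(q,p,\bar q,\bar p)$, consider the one-form $$\alpha=\sum_{j=1}^n\Big((\bar q^j-q^j)\,d\Big(\frac{\bar p^j+p^j}{2}\Big)-(\bar p^j-p^j)\,d\Big(\frac{\bar q^j+q^j}{2}\Big)\Big),$$ which satisfies $d\alpha=\sum_j(d\bar q^j\wedge d\bar p^j-dq^j\wedge dp^j)$. Then for every compact set $K\subset\mathbb R^{2n}$ there is $h_0>0$ such that for every step size $0<h<h_0$ and every $z_0\in K$ there are open sets $U\ni z_0$ and $V$ in $\mathbb R^{2n}$ with the following properties. 1. $\phi_h$ is well defined and $C^k$ on $U$, and the midpoint map $z\mapsto\frac{\phi_h(z)+z}{2}$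 is a $C^k$ diffeomorphism from $U$ onto $V$; that is, the midpoint coordinates $\big(\frac{\bar q+q}{2},\frac{\bar p+p}{2}\big)$ are a chart, with image $V$, of the graph $\Gamma_U=\{(z,\phi_h(z)) : z\in U\}$. 2. There is a $C^{k+1}$ function $S:V\to\mathbb R$ that is a generating function of $\phi_h$ in midpoint coordinates over $U$, i.e. $d\big(S\big(\frac{\bar z+z}{2}\big)\big)=\alpha$ on $\Gamma_U$. 3. A differentiable function $S:V\to\mathbb R$ is such a generating function if and only if, for all $(q,p)\in U$ and $(\bar q,\bar p)=\phi_h(q,p)$, $$\bar q=q+\nabla_pS\Big(\frac{\bar q+q}{2},\frac{\bar p+p}{2}\Big),\qquad \bar p=p-\nabla_qS\Big(\frac{\bar q+q}{2},\frac{\bar p+p}{2}\Big).\tag{$*$}$$ 4. Call a differentiable function $\overline H:V\to\mathbb R$ an inverse modified Hamiltonian over $U$ (for the implicit midpoint rule with step size $h$) if $\bar z=z+h\,J^{-1}\nabla\overline H\big(\frac{\bar z+z}{2}\big)$ for all $z\in U$, $\bar z=\phi_h(z)$. A differentiable function $\overline H:V\to\mathbb R$ is an inverse modified Hamiltonian over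 $U$ if and only if $h\overline H$ satisfies the equations $(*)$ of the generating functions (with $S$ replaced by $h\overline H$). In that case, for all $z,\bar z$ with $\frac{\bar z+z}{2}\in V$, the pair $(z,\bar z)$ satisfies $\bar z=z+h\,J^{-1}\nabla\overline H\big(\frac{\bar z+z}{2}\big)$ if and only if $z\in U$ and $\bar z=\phi_h(z)$; so the implicit midpoint rule applied to $J^{-1}\nabla\overline H$ reproduces the exact flow. 5. An inverse modified Hamiltonian $\overline H:V\to\mathbb R$ over $U$ of class $C^{k+1}$ exists. -/

import Mathlib

open Set Gradient

/-- The phase space `ℝ^{2n}` with points `z = (q, p)`: the coordinates `z (Sum.inl j)` are the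
positions `q^j`, and the coordinates `z (Sum.inr j)` are the momenta `p^j`. -/
abbrev PhaseSpace (n : ℕ) : Type := EuclideanSpace ℝ (Fin n ⊕ Fin n)

/-- The Hamiltonian vector field `J⁻¹ ∇H`, where `J = [[0, -I], [I, 0]]`. -/
noncomputable def hamVF {n : ℕ} (H : PhaseSpace n → ℝ) (z : PhaseSpace n) : PhaseSpace n :=
  WithLp.toLp 2 ((Matrix.J (Fin n) ℝ)⁻¹.mulVec (WithLp.ofLp (∇ H z)))

/-- `FlowsTo f h z z'`: some solution of `ẏ = f(y)` on `[0, h]` starts at `z` and is at `z'` at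
time `h`. -/
def FlowsTo {n : ℕ} (f : PhaseSpace n → PhaseSpace n) (h : ℝ) (z z' : PhaseSpace n) : Prop :=
  ∃ γ : ℝ → PhaseSpace n, IsIntegralCurveOn γ (fun _ => f) (Icc 0 h) ∧ γ 0 = z ∧ γ h = z'

open Classical in
/-- The exact time-`h` flow map `φ_h` of `ẏ = f(y)`. At a point from which no solution exists up
to time `h` its value is meaningless (it is set to the point itself). -/
noncomputable def flowMap {n : ℕ} (f : PhaseSpace n → PhaseSpace n) (h : ℝ)
    (z : PhaseSpace n) : PhaseSpace n :=
  if hz : ∃ z', FlowsTo f h z z' then hz.choose else z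

/-- On `U` the flow map is a genuine one: a solution on `[0, h]` exists from each point of `U`, and
its end point is uniquely determined. -/
def FlowDefinedOn {n : ℕ} (f : PhaseSpace n → PhaseSpace n) (h : ℝ)
    (U : Set (PhaseSpace n)) : Prop :=
  ∀ z ∈ U, ∀ z', FlowsTo f h z z' ↔ z' = flowMap f h z

/-- The midpoint coordinates `((q̄ + q)/2, (p̄ + p)/2)` of the pair `(z, z') = ((q, p), (q̄, p̄))`. -/
noncomputable def midpt {n : ℕ} (z z' : PhaseSpace n) : PhaseSpace n := (1 / 2 : ℝ) • (z' + z)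

/-- `z'` is obtained from `z` by one step of size `h` of the implicit midpoint rule applied to
`ẏ = f(y)`. -/
def IsMidpointStep {n : ℕ} (f : PhaseSpace n → PhaseSpace n) (h : ℝ) (z z' : PhaseSpace n) : Prop :=
  z' = z + h • f (midpt z z')

/-- The differential of the midpoint coordinate with index `i`, as a linear form on `ℝ^{2n} × ℝ^{2n}`. -/
noncomputable def dMid {n : ℕ} (i : Fin n ⊕ Fin n) :
    PhaseSpace n × PhaseSpace n →L[ℝ] ℝ :=
  (1 / 2 : ℝ) •
    ((EuclideanSpace.proj i : PhaseSpace n →L[ℝ] ℝ).comp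
        (ContinuousLinearMap.snd ℝ (PhaseSpace n) (PhaseSpace n)) +
      (EuclideanSpace.proj i : PhaseSpace n →L[ℝ] ℝ).comp
        (ContinuousLinearMap.fst ℝ (PhaseSpace n) (PhaseSpace n)))

/-- The one-form
`α = ∑ j, ((q̄^j - q^j) d((p̄^j + p^j)/2) - (p̄^j - p^j) d((q̄^j + q^j)/2))`
on `ℝ^{2n} × ℝ^{2n}` with points `(z, z') = ((q, p), (q̄, p̄))`; its exterior derivative is
`∑ j, (dq̄^j ∧ dp̄^j - dq^j ∧ dp^j)`. -/
noncomputable def alphaForm {n : ℕ} (x : PhaseSpace n × PhaseSpace n) :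
    PhaseSpace n × PhaseSpace n →L[ℝ] ℝ :=
  ∑ j : Fin n,
    ((x.2 (Sum.inl j) - x.1 (Sum.inl j)) • dMid (Sum.inr j) -
      (x.2 (Sum.inr j) - x.1 (Sum.inr j)) • dMid (Sum.inl j))

/-- The map `φ` is `C^k` on `U`, and the midpoint coordinates are a `C^k` chart, with image `V`, of
the piece `{(z, φ z) | z ∈ U}` of its graph (which is parametrised by `z ∈ U`). -/
structure IsMidpointChart {n : ℕ} (k : ℕ∞) (φ : PhaseSpace n → PhaseSpace n)
    (U V : Set (PhaseSpace n)) : Prop where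
  isOpen_source : IsOpen U
  isOpen_target : IsOpen V
  contDiffOn_map : ContDiffOn ℝ k φ U
  bijOn : BijOn (fun z => midpt z (φ z)) U V
  contDiffOn_symm : ∃ ψ : PhaseSpace n → PhaseSpace n,
    InvOn ψ (fun z => midpt z (φ z)) U V ∧ ContDiffOn ℝ k ψ V

/-- `S`, a function of the midpoint coordinates, is a generating function of `φ` over `U`: on the
graph of `φ`, parametrised by `z ↦ (z, φ z)` with `z ∈ U`, one has `dS = α`, i.e. the differential
of `z ↦ S ((φ z + z)/2)` is the pullback of `α` along `z ↦ (z, φ z)`. -/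
def IsMidpointGeneratingFunction {n : ℕ} (φ : PhaseSpace n → PhaseSpace n)
    (U : Set (PhaseSpace n)) (S : PhaseSpace n → ℝ) : Prop :=
  ∀ z ∈ U, HasFDerivAt (fun w => S (midpt w (φ w)))
    ((alphaForm (z, φ z)).comp ((ContinuousLinearMap.id ℝ (PhaseSpace n)).prod (fderiv ℝ φ z))) z

/-- The partial differential equations of a generating function in midpoint coordinates: with
`(q̄, p̄) = φ (q, p)`,
`q̄ = q + ∇_p S ((q̄ + q)/2, (p̄ + p)/2)` and `p̄ = p - ∇_q S ((q̄ + q)/2, (p̄ + p)/2)`. -/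
def SatisfiesMidpointPDE {n : ℕ} (φ : PhaseSpace n → PhaseSpace n)
    (U : Set (PhaseSpace n)) (S : PhaseSpace n → ℝ) : Prop :=
  ∀ z ∈ U, ∀ j : Fin n,
    φ z (Sum.inl j) = z (Sum.inl j) + (∇ S (midpt z (φ z))) (Sum.inr j) ∧
    φ z (Sum.inr j) = z (Sum.inr j) - (∇ S (midpt z (φ z))) (Sum.inl j)

/-- `Hbar` is an inverse modified Hamiltonian over `U` for the implicit midpoint rule with step
size `h`: one step of the rule applied to `J⁻¹ ∇Hbar` yields `φ z` from each `z ∈ U`. -/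
def IsInverseModifiedHamiltonian {n : ℕ} (φ : PhaseSpace n → PhaseSpace n) (h : ℝ)
    (U : Set (PhaseSpace n)) (Hbar : PhaseSpace n → ℝ) : Prop :=
  ∀ z ∈ U, IsMidpointStep (hamVF Hbar) h z (φ z)

/-!
Rescaling time to `[0, 1]` turns a solution of `ẏ = f(y)` up to time `h` into a solution
`y ∈ C([0, 1], ℝ^{2n})` of `y = z + h ∫ f ∘ y`. Composition with `f` is a `C^k` map of the Banach
space `C([0, 1], ℝ^{2n})`, and at `h = 0` the equation reads `y = z`, so the inverse function
theorem gives a flow that is jointly `C^k` in `(h, z)` near `h = 0`. The midpoint map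
`z ↦ (φ_h z + z) / 2` is the identity at `h = 0` as well, and the inverse function theorem, applied
with `h` as a parameter, makes it a chart whose domain and image can be chosen uniformly for small
`h`; compactness of `K` then gives `h₀`.

Let `ω` be the symplectic form and `ψ` the inverse of the midpoint chart. On the graph of `φ`, the
one-form `α` at `(z, φ z)` evaluates `ω(φ z - z, ·)` on midpoint displacements. In midpoint
coordinates it is thus `w ↦ ω(φ (ψ w) - ψ w, ·)`, and by the Cayley transform identity this
one-form is closed when `φ` is symplectic. The Poincaré lemma on a ball yields `S`, and since
`ω(J⁻¹ ∇S, ·) = dS`, the equation `dS = α` says `φ z - z = J⁻¹ ∇S`. Dividing by `h` gives the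
inverse modified Hamiltonian `S / h`.
-/

section PointwiseApply

variable {𝕜 : Type*} [NontriviallyNormedField 𝕜] {X : Type*} [TopologicalSpace X] [CompactSpace X]
  {E F : Type*} [NormedAddCommGroup E] [NormedSpace 𝕜 E] [NormedAddCommGroup F] [NormedSpace 𝕜 F]

/-- Pointwise application of a continuous family of operators to a continuous family of vectors. -/
noncomputable def pointwiseApply : C(X, E →L[𝕜] F) →L[𝕜] C(X, E) →L[𝕜] C(X, F) :=
  LinearMap.mkContinuous₂
    (LinearMap.mk₂ 𝕜 (fun (A : C(X, E →L[𝕜] F)) (v : C(X, E)) =>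
        (⟨fun t => A t (v t), by fun_prop⟩ : C(X, F)))
      (fun _ _ _ => rfl) (fun _ _ _ => rfl)
      (fun _ _ _ => by ext; simp) (fun _ _ _ => by ext; simp))
    1 (fun A v => (ContinuousMap.norm_le _ (by positivity)).2 fun t => by
      rw [one_mul]
      exact (A t).le_of_opNorm_le_of_le (A.norm_coe_le_norm t) (v.norm_coe_le_norm t))

end PointwiseApply

section Superposition

open Topology

variable {𝕜 : Type*} [RCLike 𝕜] {X : Type*} [TopologicalSpace X] [CompactSpace X]

theorem hasFDerivAt_postcomp {E F : Type*} [NormedAddCommGroup E] [NormedSpace 𝕜 E]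
    [NormedAddCommGroup F] [NormedSpace 𝕜 F] {f : C(E, F)} {f' : C(E, E →L[𝕜] F)}
    (hf : ∀ x, HasFDerivAt f (f' x) x) (y : C(X, E)) :
    HasFDerivAt (fun y : C(X, E) => f.comp y) (pointwiseApply (f'.comp y)) y := by
  rw [hasFDerivAt_iff_isLittleO, Asymptotics.isLittleO_iff]
  intro ε hε
  let := NormedSpace.restrictScalars ℝ 𝕜 E
  obtain ⟨δ, hδ, hf'⟩ := (Metric.continuousAt_iff (f := fun w : C(X, E) => f'.comp w)).1
    (f'.continuous_postcomp.continuousAt (x := y)) ε hε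
  have hf'_near : ∀ t, ∀ x ∈ Metric.ball (y t) δ, ‖f' x - f' (y t)‖ ≤ ε := fun t x hx => by
    have hshift : dist (y + ContinuousMap.const X (x - y t)) y < δ := by
      rw [dist_eq_norm, add_sub_cancel_left]
      exact ((ContinuousMap.norm_le _ (norm_nonneg _)).2 fun _ => le_rfl).trans_lt
        (mem_ball_iff_norm.1 hx)
    simpa [dist_eq_norm] using (ContinuousMap.dist_apply_le_dist t).trans (hf' hshift).le
  filter_upwards [Metric.ball_mem_nhds y hδ] with w hw
  refine (ContinuousMap.norm_le _ (by positivity)).2 fun t => ?_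
  calc ‖f (w t) - f (y t) - f' (y t) (w t - y t)‖
      ≤ ε * ‖w t - y t‖ :=
        (convex_ball (y t) δ).norm_image_sub_le_of_norm_hasFDerivWithin_le'
          (fun x _ => (hf x).hasFDerivWithinAt) (hf'_near t) (Metric.mem_ball_self hδ)
          ((ContinuousMap.dist_apply_le_dist t).trans_lt hw)
    _ ≤ ε * ‖w - y‖ := by gcongr; exact (w - y).norm_coe_le_norm t

universe u

variable {E F : Type u} [NormedAddCommGroup E] [NormedSpace 𝕜 E] [NormedAddCommGroup F]
  [NormedSpace 𝕜 F]

theorem contDiff_nat_postcomp (m : ℕ) : ∀ {F : Type u} [NormedAddCommGroup F] [NormedSpace 𝕜 F]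
    {f : C(E, F)}, ContDiff 𝕜 m f → ContDiff 𝕜 m (fun y : C(X, E) => f.comp y) := by
  induction m with
  | zero => exact fun {_} _ _ {f} _ => contDiff_zero.2 f.continuous_postcomp
  | succ m ih =>
    intro F _ _ f hf
    push_cast at hf ⊢
    obtain ⟨hdiff, -, hf'⟩ := contDiff_succ_iff_fderiv.1 hf
    exact contDiff_succ_iff_hasFDerivAt.2 ⟨_,
      pointwiseApply.contDiff.comp (ih (f := ⟨fderiv 𝕜 f, hf'.continuous⟩) hf'),
      hasFDerivAt_postcomp fun x => (hdiff x).hasFDerivAt⟩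

theorem contDiff_postcomp {k : ℕ∞} {f : C(E, F)} (hf : ContDiff 𝕜 k f) :
    ContDiff 𝕜 k (fun y : C(X, E) => f.comp y) :=
  contDiff_iff_forall_nat_le.2 fun m hm =>
    contDiff_nat_postcomp m (hf.of_le (by exact_mod_cast hm))

end Superposition

section InverseFunction

variable {𝕜 : Type*} [RCLike 𝕜] {E F P : Type*} [NormedAddCommGroup E] [NormedSpace 𝕜 E]
  [CompleteSpace E] [NormedAddCommGroup F] [NormedSpace 𝕜 F] [NormedAddCommGroup P]
  [NormedSpace 𝕜 P] [CompleteSpace P] {k : WithTop ℕ∞}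

theorem exists_openPartialHomeomorph_contDiffOn_symm {f : E → F} {O : Set E}
    (hf : ContDiffOn 𝕜 k f O) (hO : IsOpen O) (hk : k ≠ 0) {x : E} (hx : x ∈ O) {f' : E ≃L[𝕜] F}
    (hf' : HasFDerivAt f (f' : E →L[𝕜] F) x) :
    ∃ e : OpenPartialHomeomorph E F, ⇑e = f ∧ x ∈ e.source ∧ e.source ⊆ O ∧
      ContDiffOn 𝕜 k e.symm e.target := by
  -- Shrinking to the open set of points with invertible derivative covers `k = ∞`, where
  -- smoothness at `x` alone would not give a single neighbourhood on which the inverse is smooth.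
  set A : Set E := O ∩ fderiv 𝕜 f ⁻¹' range ((↑) : (E ≃L[𝕜] F) → E →L[𝕜] F)
  have hf'cont : ContinuousOn (fderiv 𝕜 f) O :=
    hf.continuousOn_fderiv_of_isOpen hO (ENat.one_le_iff_ne_zero_withTop.2 hk)
  have hAo : IsOpen A := hf'cont.isOpen_inter_preimage hO ContinuousLinearEquiv.isOpen
  have hfAt : ∀ y ∈ O, ContDiffAt 𝕜 k f y := fun y hy => hf.contDiffAt (hO.mem_nhds hy)
  refine ⟨((hfAt x hx).toOpenPartialHomeomorph f hf' hk).restrOpen A hAo, rfl,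
    ⟨(hfAt x hx).mem_toOpenPartialHomeomorph_source hf' hk, hx, f', hf'.fderiv.symm⟩,
    fun y hy => hy.2.1, fun w hw => ?_⟩
  set e := ((hfAt x hx).toOpenPartialHomeomorph f hf' hk).restrOpen A hAo
  obtain ⟨hyO, g', hg'⟩ : e.symm w ∈ A := (e.map_target hw).2
  exact (e.contDiffAt_symm hw (f₀' := g') (hg' ▸ ((hfAt _ hyO).differentiableAt hk).hasFDerivAt)
    (hfAt _ hyO)).contDiffWithinAt

theorem exists_openPartialHomeomorph_prodMk_of_eq_id {G : P × E → E} {O : Set (P × E)}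
    (hG : ContDiffOn 𝕜 k G O) (hO : IsOpen O) (hk : k ≠ 0) {p₀ : P} {x₀ : E} (hx₀ : (p₀, x₀) ∈ O)
    (hid : ∀ x, (p₀, x) ∈ O → G (p₀, x) = x) :
    ∃ e : OpenPartialHomeomorph (P × E) (P × E), (⇑e = fun y => (y.1, G y)) ∧
      (p₀, x₀) ∈ e.source ∧ e.source ⊆ O ∧ ContDiffOn 𝕜 k e.symm e.target := by
  have hGd : HasFDerivAt G (fderiv 𝕜 G (p₀, x₀)) (p₀, x₀) :=
    ((hG.contDiffAt (hO.mem_nhds hx₀)).differentiableAt hk).hasFDerivAt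
  have hslice : (fderiv 𝕜 G (p₀, x₀)).comp (ContinuousLinearMap.inr 𝕜 P E) =
      ContinuousLinearMap.id 𝕜 E :=
    (hGd.comp x₀ (hasFDerivAt_prodMk_right p₀ x₀)).unique <|
      (hasFDerivAt_id x₀).congr_of_eventuallyEq <| Filter.mem_of_superset
        ((hO.preimage (Continuous.prodMk_right p₀)).mem_nhds hx₀) hid
  refine exists_openPartialHomeomorph_contDiffOn_symm (contDiff_fst.contDiffOn.prodMk hG) hO hk hx₀
    (f' := .skewProd (.refl 𝕜 P) (.refl 𝕜 E)
      ((fderiv 𝕜 G (p₀, x₀)).comp (ContinuousLinearMap.inl 𝕜 P E)))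
    ((hasFDerivAt_fst.prodMk hGd).congr_fderiv ?_)
  ext v
  · simp
  · simp
  · simp
  · simpa [← Prod.zero_eq_mk] using congr($hslice v)

end InverseFunction

section Integration

open unitInterval MeasureTheory

variable {E F : Type*} [NormedAddCommGroup E] [NormedSpace ℝ E] [NormedAddCommGroup F]
  [NormedSpace ℝ F]

/-- The operator taking a continuous path `g` on `[0, 1]` to its primitive `t ↦ ∫ s in 0..t, g s`
vanishing at `0`. -/
noncomputable def primitive : C(I, E) →L[ℝ] C(I, E) :=
  have hint (g : C(I, E)) (a b : ℝ) : IntervalIntegrable (IccExtend zero_le_one g) volume a b :=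
    g.continuous.Icc_extend'.intervalIntegrable a b
  LinearMap.mkContinuous
    { toFun := fun g => ⟨fun t => ∫ s in (0 : ℝ)..t, IccExtend zero_le_one g s,
        (intervalIntegral.continuous_primitive (hint g) 0).comp continuous_subtype_val⟩
      map_add' := fun g₁ g₂ => by
        ext t
        exact intervalIntegral.integral_add (hint g₁ _ _) (hint g₂ _ _)
      map_smul' := fun c g => by
        ext t
        exact intervalIntegral.integral_smul c _ }
    1 (fun g => by
      refine (ContinuousMap.norm_le _ (by positivity)).2 fun t => ?_
      refine (intervalIntegral.norm_integral_le_of_norm_le_const (C := ‖g‖)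
        fun s _ => g.norm_coe_le_norm _).trans ?_
      rw [sub_zero, abs_of_nonneg t.2.1, mul_comm]
      gcongr
      exact t.2.2)

theorem primitive_apply (g : C(I, E)) (t : I) :
    primitive g t = ∫ s in (0 : ℝ)..t, IccExtend zero_le_one g s := rfl

@[simp]
theorem primitive_apply_zero (g : C(I, E)) : primitive g 0 = 0 := by
  simp [primitive_apply]

variable [CompleteSpace E]

theorem hasDerivWithinAt_of_eq_const_add_primitive {y g : C(I, E)} {z : E}
    (hy : y = .const I z + primitive g) {t : ℝ} (ht : t ∈ Icc (0 : ℝ) 1) :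
    HasDerivWithinAt (IccExtend zero_le_one y) (IccExtend zero_le_one g t) (Icc 0 1) t := by
  have hg : Continuous (IccExtend (zero_le_one' ℝ) g) := g.continuous.Icc_extend'
  have hy_eq : ∀ s ∈ Icc (0 : ℝ) 1,
      IccExtend zero_le_one y s = z + ∫ r in (0 : ℝ)..s, IccExtend zero_le_one g r :=
    fun s hs => by
      rw [IccExtend_of_mem zero_le_one _ hs, hy]
      rfl
  exact ((hg.integral_hasStrictDerivAt 0 t).hasDerivAt.const_add z).hasDerivWithinAt.congr
    hy_eq (hy_eq t ht)

theorem bilin_apply_eq_of_eq_const_add_primitive {B : E →L[ℝ] E →L[ℝ] F} {A : C(I, E →L[ℝ] E)}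
    (hA : ∀ t u v, B (A t u) v + B u (A t v) = 0) {a b : C(I, E)} {u v : E}
    (ha : a = .const I u + primitive (pointwiseApply A a))
    (hb : b = .const I v + primitive (pointwiseApply A b)) (t : I) : B (a t) (b t) = B u v := by
  have hderiv : ∀ s ∈ Icc (0 : ℝ) 1, HasDerivWithinAt
      (fun s => B (IccExtend zero_le_one a s) (IccExtend zero_le_one b s)) 0 (Icc 0 1) s :=
    fun s hs => by
      convert B.hasDerivWithinAt_of_bilinear (hasDerivWithinAt_of_eq_const_add_primitive ha hs)
        (hasDerivWithinAt_of_eq_const_add_primitive hb hs) using 1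
      rw [add_comm]
      exact (hA _ _ _).symm
  have hconst := constant_of_derivWithin_zero (fun s hs => (hderiv s hs).differentiableWithinAt)
    (fun s hs => (hderiv s (Ico_subset_Icc_self hs)).derivWithin
      (uniqueDiffOn_Icc_zero_one s (Ico_subset_Icc_self hs))) t t.2
  have ha₀ : a 0 = u := by rw [ha]; simp
  have hb₀ : b 0 = v := by rw [hb]; simp
  simpa [ha₀, hb₀] using hconst

end Integration

section IntegralSolution

open unitInterval Topology

variable {E F : Type*} [NormedAddCommGroup E] [NormedSpace ℝ E] [NormedAddCommGroup F]
  [NormedSpace ℝ F] {f : C(E, E)} {h : ℝ} {z : E}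

/-- The path `y` solves the integral equation `y t = z + h ∫ s in 0..t, f (y s)` on `[0, 1]`, so
that `s ↦ y (s / h)` solves `ẏ = f(y)`. With time rescaled to `[0, 1]` the step size `h` becomes a
parameter of an equation on the fixed space `C([0, 1], E)`. -/
def IsIntegralSolution (f : C(E, E)) (h : ℝ) (z : E) (y : C(I, E)) : Prop :=
  y = .const I z + h • primitive (f.comp y)

theorem IsIntegralSolution.apply_zero {y : C(I, E)} (hy : IsIntegralSolution f h z y) :
    y 0 = z := by
  rw [hy]
  simp

theorem IsIntegralSolution.isIntegralCurveOn [CompleteSpace E] {y : C(I, E)}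
    (hy : IsIntegralSolution f h z y) (hh : 0 < h) :
    IsIntegralCurveOn (fun t => IccExtend zero_le_one y (t * h⁻¹)) (fun _ => f) (Icc 0 h) := by
  have hy' : y = .const I z + primitive (h • f.comp y) := by
    rw [map_smul]
    exact hy
  have hcurve : IsIntegralCurveOn (IccExtend zero_le_one y) (fun _ x => h • f x) (Icc 0 1) :=
    fun t ht => hasDerivWithinAt_of_eq_const_add_primitive hy' ht
  have hscaled := hcurve.comp_mul h⁻¹
  simp only [Function.comp_def, Pi.smul_def, inv_smul_smul₀ hh.ne'] at hscaled
  exact hscaled.mono fun t ht =>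
    ⟨mul_nonneg ht.1 (inv_nonneg.2 hh.le), mul_inv_le_one_of_le₀ ht.2 hh.le⟩

theorem apply_eq_const_add_primitive_of_hasFDerivAt {f' : C(E, E →L[ℝ] E)}
    (hf : ∀ x, HasFDerivAt f (f' x) x) {Y : E → C(I, E)} {Y' : E →L[ℝ] C(I, E)}
    (hY : HasFDerivAt Y Y' z) (hsol : ∀ᶠ w in 𝓝 z, IsIntegralSolution f h w (Y w)) (u : E) :
    Y' u = .const I u + primitive (pointwiseApply (h • f'.comp (Y z)) (Y' u)) := by
  have hrhs : HasFDerivAt Y (.const ℝ I + h • primitive.comp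
      ((pointwiseApply (f'.comp (Y z))).comp Y')) z :=
    HasFDerivAt.congr_of_eventuallyEq ((ContinuousLinearMap.const ℝ I).hasFDerivAt.add
      ((primitive.hasFDerivAt.comp z
        ((hasFDerivAt_postcomp hf (Y z)).comp z hY)).const_smul h)) hsol
  refine congr($(hY.unique hrhs) u).trans ?_
  rw [map_smul, smul_apply, map_smul]
  rfl

theorem bilin_fderiv_eq_of_isIntegralSolution [CompleteSpace E] {B : E →L[ℝ] E →L[ℝ] F}
    (hf : ContDiff ℝ 1 f) (hB : ∀ x u v, B (fderiv ℝ f x u) v + B u (fderiv ℝ f x v) = 0)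
    {Y : E → C(I, E)} (hY : DifferentiableAt ℝ Y z)
    (hsol : ∀ᶠ w in 𝓝 z, IsIntegralSolution f h w (Y w)) (t : I) (u v : E) :
    B (fderiv ℝ (fun w => Y w t) z u) (fderiv ℝ (fun w => Y w t) z v) = B u v := by
  have hvar := apply_eq_const_add_primitive_of_hasFDerivAt
    (f' := ⟨fderiv ℝ f, hf.continuous_fderiv one_ne_zero⟩)
    (fun x => (hf.differentiable one_ne_zero x).hasFDerivAt) hY.hasFDerivAt hsol
  have heval : fderiv ℝ (fun w => Y w t) z = (ContinuousMap.evalCLM ℝ t).comp (fderiv ℝ Y z) :=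
    ((ContinuousMap.evalCLM ℝ t : C(I, E) →L[ℝ] E).hasFDerivAt.comp z hY.hasFDerivAt).fderiv
  rw [heval]
  refine bilin_apply_eq_of_eq_const_add_primitive (fun s a b => ?_) (hvar u) (hvar v) t
  simp [← smul_add, hB]

theorem exists_contDiffOn_isIntegralSolution [CompleteSpace E] {k : ℕ∞} (hk : k ≠ 0)
    (hf : ContDiff ℝ k f) (z₀ : E) :
    ∃ W : Set (ℝ × E), IsOpen W ∧ ((0 : ℝ), z₀) ∈ W ∧ ∃ Y : ℝ × E → C(I, E),
      ContDiffOn ℝ k Y W ∧ ∀ p ∈ W, IsIntegralSolution f p.1 p.2 (Y p) := by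
  have hG : ContDiff ℝ k fun p : ℝ × C(I, E) => p.2 - p.1 • primitive (f.comp p.2) :=
    contDiff_snd.sub (contDiff_fst.smul
      (primitive.contDiff.comp ((contDiff_postcomp hf).comp contDiff_snd)))
  obtain ⟨e, he, hmem, -, hsymm⟩ := exists_openPartialHomeomorph_prodMk_of_eq_id hG.contDiffOn
    isOpen_univ (by exact_mod_cast hk) (mem_univ ((0 : ℝ), ContinuousMap.const I z₀)) (by simp)
  let j (p : ℝ × E) : ℝ × C(I, E) := (p.1, .const I p.2)
  have hj : ContDiff ℝ k j :=
    contDiff_fst.prodMk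
      ((ContinuousLinearMap.const ℝ I : E →L[ℝ] C(I, E)).contDiff.comp contDiff_snd)
  refine ⟨j ⁻¹' e.target, e.open_target.preimage hj.continuous, ?_, fun p => (e.symm (j p)).2,
    contDiff_snd.comp_contDiffOn (hsymm.comp hj.contDiffOn fun _ hp => hp), fun p hp => ?_⟩
  · have hfixed := e.map_source hmem
    simpa [he, j] using hfixed
  · obtain ⟨htime, hpath⟩ := Prod.ext_iff.1 ((congrFun he _).symm.trans (e.right_inv hp))
    simp only at htime hpath
    rw [htime] at hpath
    exact sub_eq_iff_eq_add.1 hpath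

end IntegralSolution

section Uniqueness

variable {E : Type*} [NormedAddCommGroup E] [NormedSpace ℝ E]

theorem eqOn_Icc_of_isIntegralCurveOn {v : E → E} (hv : LocallyLipschitz v) {a b : ℝ}
    {γ η : ℝ → E} (hγ : IsIntegralCurveOn γ (fun _ => v) (Icc a b))
    (hη : IsIntegralCurveOn η (fun _ => v) (Icc a b)) (hab : γ a = η a) : EqOn γ η (Icc a b) := by
  have hcompact : IsCompact (γ '' Icc a b ∪ η '' Icc a b) :=
    (isCompact_Icc.image_of_continuousOn hγ.continuousOn).union
      (isCompact_Icc.image_of_continuousOn hη.continuousOn)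
  obtain ⟨C, hC⟩ := hv.locallyLipschitzOn.exists_lipschitzOnWith_of_compact hcompact
  have hright : ∀ {α : ℝ → E}, IsIntegralCurveOn α (fun _ => v) (Icc a b) →
      ∀ t ∈ Ico a b, HasDerivWithinAt α (v (α t)) (Ici t) t := fun hα t ht =>
    (hα t (Ico_subset_Icc_self ht)).mono_of_mem_nhdsWithin (Icc_mem_nhdsGE_of_mem ht)
  exact ODE_solution_unique_of_mem_Icc_right (fun _ _ => hC)
    hγ.continuousOn (hright hγ) (fun t ht => .inl (mem_image_of_mem γ (Ico_subset_Icc_self ht)))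
    hη.continuousOn (hright hη) (fun t ht => .inr (mem_image_of_mem η (Ico_subset_Icc_self ht))) hab

end Uniqueness

section Flow

open unitInterval

variable {n : ℕ} {f : PhaseSpace n → PhaseSpace n} {h : ℝ} {z a b : PhaseSpace n}

theorem FlowsTo.unique (hf : LocallyLipschitz f) (hh : 0 ≤ h) (ha : FlowsTo f h z a)
    (hb : FlowsTo f h z b) : a = b := by
  obtain ⟨γ, hγ, hγ₀, rfl⟩ := ha
  obtain ⟨η, hη, hη₀, rfl⟩ := hb
  exact eqOn_Icc_of_isIntegralCurveOn hf hγ hη (hγ₀.trans hη₀.symm) (right_mem_Icc.2 hh)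

theorem FlowsTo.flowMap_eq (hf : LocallyLipschitz f) (hh : 0 ≤ h) (ha : FlowsTo f h z a) :
    flowMap f h z = a := by
  have hz : ∃ z', FlowsTo f h z z' := ⟨a, ha⟩
  rw [flowMap, dif_pos hz]
  exact hz.choose_spec.unique hf hh ha

theorem flowDefinedOn_of_forall_flowsTo (hf : LocallyLipschitz f) (hh : 0 ≤ h)
    {U : Set (PhaseSpace n)} (hU : ∀ z ∈ U, ∃ z', FlowsTo f h z z') : FlowDefinedOn f h U := by
  refine fun z hz z' => ⟨fun hz' => (hz'.flowMap_eq hf hh).symm, ?_⟩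
  rintro rfl
  obtain ⟨a, ha⟩ := hU z hz
  rwa [ha.flowMap_eq hf hh]

theorem IsIntegralSolution.flowsTo {f : C(PhaseSpace n, PhaseSpace n)} {y : C(I, PhaseSpace n)}
    (hy : IsIntegralSolution f h z y) (hh : 0 < h) : FlowsTo f h z (y 1) := by
  refine ⟨_, hy.isIntegralCurveOn hh, ?_, ?_⟩
  · rw [zero_mul, IccExtend_left]
    exact hy.apply_zero
  · rw [mul_inv_cancel₀ hh.ne', IccExtend_right]
    rfl

theorem exists_contDiffOn_flow {k : ℕ∞} (hk : k ≠ 0) (hf : ContDiff ℝ k f)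
    {B : PhaseSpace n →L[ℝ] PhaseSpace n →L[ℝ] ℝ}
    (hB : ∀ x u v, B (fderiv ℝ f x u) v + B u (fderiv ℝ f x v) = 0) (z₀ : PhaseSpace n) :
    ∃ W : Set (ℝ × PhaseSpace n), IsOpen W ∧ ((0 : ℝ), z₀) ∈ W ∧
      ∃ Φ : ℝ × PhaseSpace n → PhaseSpace n, ContDiffOn ℝ k Φ W ∧
        (∀ z, ((0 : ℝ), z) ∈ W → Φ (0, z) = z) ∧
        (∀ h z, (h, z) ∈ W → 0 < h → FlowsTo f h z (Φ (h, z))) ∧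
        ∀ h z, (h, z) ∈ W → ∀ u v,
          B (fderiv ℝ (fun w => Φ (h, w)) z u) (fderiv ℝ (fun w => Φ (h, w)) z v) = B u v := by
  have hk' : (k : WithTop ℕ∞) ≠ 0 := by exact_mod_cast hk
  let F : C(PhaseSpace n, PhaseSpace n) := ⟨f, hf.continuous⟩
  obtain ⟨W, hW, hz₀, Y, hY, hsol⟩ := exists_contDiffOn_isIntegralSolution (f := F) hk hf z₀
  refine ⟨W, hW, hz₀, fun p => Y p 1, ?_, fun z hz => ?_, fun h z hz => (hsol _ hz).flowsTo,
    fun h z hz => ?_⟩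
  · exact (ContinuousMap.evalCLM ℝ (1 : I) : C(I, PhaseSpace n) →L[ℝ] _).contDiff.comp_contDiffOn hY
  · simpa using congr($(hsol _ hz) 1)
  · have hYz : DifferentiableAt ℝ (fun w => Y (h, w)) z :=
      ((hY.differentiableOn hk').differentiableAt (hW.mem_nhds hz)).comp z (by fun_prop)
    have hnear : ∀ᶠ w in nhds z, (h, w) ∈ W :=
      (hW.preimage (Continuous.prodMk_right h)).mem_nhds hz
    exact bilin_fderiv_eq_of_isIntegralSolution
      (hf.of_le (ENat.one_le_iff_ne_zero_withTop.2 hk')) hB hYz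
      (hnear.mono fun w hw => hsol _ hw) 1

end Flow

section Symplectic

variable {n : ℕ}

/-- The standard symplectic form `ω(x, v) = ∑ j, (x_q^j v_p^j - x_p^j v_q^j)` on `ℝ^{2n}`. With
this sign a Hamiltonian vector field satisfies `ω(J⁻¹ ∇H, ·) = dH`. -/
noncomputable def symplecticForm (n : ℕ) : PhaseSpace n →L[ℝ] PhaseSpace n →L[ℝ] ℝ :=
  ∑ j : Fin n,
    ((EuclideanSpace.proj (Sum.inl j) : PhaseSpace n →L[ℝ] ℝ).smulRight
        (EuclideanSpace.proj (Sum.inr j) : PhaseSpace n →L[ℝ] ℝ) -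
      (EuclideanSpace.proj (Sum.inr j) : PhaseSpace n →L[ℝ] ℝ).smulRight
        (EuclideanSpace.proj (Sum.inl j) : PhaseSpace n →L[ℝ] ℝ))

theorem symplecticForm_apply (x v : PhaseSpace n) :
    symplecticForm n x v =
      ∑ j : Fin n, (x (Sum.inl j) * v (Sum.inr j) - x (Sum.inr j) * v (Sum.inl j)) := by
  simp [symplecticForm]

theorem symplecticForm_antisymm (x v : PhaseSpace n) :
    symplecticForm n x v = -symplecticForm n v x := by
  simp only [symplecticForm_apply, ← Finset.sum_neg_distrib]
  exact Finset.sum_congr rfl fun j _ => by ring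

theorem symplecticForm_injective : Function.Injective (symplecticForm n) := by
  refine (injective_iff_map_eq_zero _).2 fun x hx => ?_
  ext (j | j)
  · simpa [symplecticForm_apply] using congr($hx (EuclideanSpace.single (Sum.inr j) 1))
  · simpa [symplecticForm_apply] using congr($hx (EuclideanSpace.single (Sum.inl j) 1))

theorem hamVF_inl (H : PhaseSpace n → ℝ) (z : PhaseSpace n) (j : Fin n) :
    hamVF H z (Sum.inl j) = ∇ H z (Sum.inr j) := by
  rw [hamVF, Matrix.J_inv]
  simp [Matrix.J, Matrix.fromBlocks_mulVec, Matrix.neg_mulVec]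

theorem hamVF_inr (H : PhaseSpace n → ℝ) (z : PhaseSpace n) (j : Fin n) :
    hamVF H z (Sum.inr j) = -∇ H z (Sum.inl j) := by
  rw [hamVF, Matrix.J_inv]
  simp [Matrix.J, Matrix.fromBlocks_mulVec, Matrix.neg_mulVec]

theorem symplecticForm_hamVF (H : PhaseSpace n → ℝ) (z : PhaseSpace n) :
    symplecticForm n (hamVF H z) = fderiv ℝ H z := by
  ext v
  have hgrad : fderiv ℝ H z v = inner ℝ (∇ H z) v := by simp [gradient]
  rw [hgrad, symplecticForm_apply, PiLp.inner_apply, Fintype.sum_sum_type,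
    ← Finset.sum_add_distrib]
  refine Finset.sum_congr rfl fun j _ => ?_
  simp only [hamVF_inl, hamVF_inr, RCLike.inner_apply, conj_trivial]
  ring

theorem eq_hamVF_iff {H : PhaseSpace n → ℝ} {x z : PhaseSpace n} :
    x = hamVF H z ↔ symplecticForm n x = fderiv ℝ H z := by
  rw [← symplecticForm_hamVF, symplecticForm_injective.eq_iff]

theorem contDiff_hamVF {k : WithTop ℕ∞} {H : PhaseSpace n → ℝ} (hH : ContDiff ℝ (k + 1) H) :
    ContDiff ℝ k (hamVF H) :=
  (Matrix.toEuclideanCLM (𝕜 := ℝ) (Matrix.J (Fin n) ℝ)⁻¹).contDiff.comp <|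
    (InnerProductSpace.toDual ℝ (PhaseSpace n)).symm.contDiff.comp
      (contDiff_succ_iff_fderiv.1 hH).2.2

theorem symplecticForm_fderiv_hamVF_skew {H : PhaseSpace n → ℝ} (hH : ContDiff ℝ 2 H)
    (x u v : PhaseSpace n) :
    symplecticForm n (fderiv ℝ (hamVF H) x u) v +
      symplecticForm n u (fderiv ℝ (hamVF H) x v) = 0 := by
  have hdiff : DifferentiableAt ℝ (hamVF H) x :=
    (contDiff_hamVF (k := 1) hH).differentiable one_ne_zero x
  have hhess : fderiv ℝ (fderiv ℝ H) x = (symplecticForm n).comp (fderiv ℝ (hamVF H) x) := by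
    rw [← funext (symplecticForm_hamVF H)]
    exact ((symplecticForm n).hasFDerivAt.comp x hdiff.hasFDerivAt).fderiv
  have hsymm : symplecticForm n (fderiv ℝ (hamVF H) x u) v =
      symplecticForm n (fderiv ℝ (hamVF H) x v) u := by
    have hsnd : IsSymmSndFDerivAt ℝ H x := hH.contDiffAt.isSymmSndFDerivAt (by simp)
    rw [IsSymmSndFDerivAt, hhess] at hsnd
    exact hsnd u v
  rw [symplecticForm_antisymm u, hsymm, add_neg_cancel]

theorem alphaForm_apply (x v : PhaseSpace n × PhaseSpace n) :
    alphaForm x v = symplecticForm n (x.2 - x.1) (midpt v.1 v.2) := by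
  rw [alphaForm, sum_apply, symplecticForm_apply]
  rfl

theorem symplecticForm_sub_midpt_of_eq {u u' v v' : PhaseSpace n}
    (h : symplecticForm n u' v' = symplecticForm n u v) :
    symplecticForm n (u' - u) (midpt v v') = symplecticForm n (v' - v) (midpt u u') := by
  simp only [midpt, map_sub, map_add, map_smul, sub_apply, smul_eq_mul]
  linarith [symplecticForm_antisymm u v, symplecticForm_antisymm u' v',
    symplecticForm_antisymm u v', symplecticForm_antisymm u' v]

/-- `φ` is symplectic at the points of `U`: its derivative there preserves the symplectic form. -/
def IsSymplecticOn (φ : PhaseSpace n → PhaseSpace n) (U : Set (PhaseSpace n)) : Prop :=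
  ∀ z ∈ U, ∀ u v,
    symplecticForm n (fderiv ℝ φ z u) (fderiv ℝ φ z v) = symplecticForm n u v

theorem IsSymplecticOn.congr {φ φ' : PhaseSpace n → PhaseSpace n} {U : Set (PhaseSpace n)}
    (hφ : IsSymplecticOn φ U) (hU : IsOpen U) (heq : EqOn φ' φ U) : IsSymplecticOn φ' U :=
  fun z hz => by
    rw [(heq.eventuallyEq_of_mem (hU.mem_nhds hz)).fderiv_eq]
    exact hφ z hz

end Symplectic

section Chart

variable {n : ℕ} {k : ℕ∞} {φ φ' ψ : PhaseSpace n → PhaseSpace n} {U V : Set (PhaseSpace n)}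

theorem eq_and_eq_of_midpt_eq_of_sub_eq {a b c d : PhaseSpace n} (hm : midpt a b = midpt c d)
    (hs : b - a = d - c) : a = c ∧ b = d := by
  have ha (x y : PhaseSpace n) : x = midpt x y - (1 / 2 : ℝ) • (y - x) := by
    rw [midpt]
    module
  have hac : a = c := by rw [ha a b, hm, hs, ← ha c d]
  exact ⟨hac, sub_left_injective (hac ▸ hs)⟩

theorem hamVF_const_mul {H : PhaseSpace n → ℝ} {z : PhaseSpace n} (hH : DifferentiableAt ℝ H z)
    (c : ℝ) : hamVF (fun y => c * H y) z = c • hamVF H z :=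
  Eq.symm <| eq_hamVF_iff.2 <| by
    rw [map_smul, symplecticForm_hamVF, fderiv_const_mul hH]

theorem satisfiesMidpointPDE_iff {S : PhaseSpace n → ℝ} :
    SatisfiesMidpointPDE φ U S ↔ ∀ z ∈ U, φ z - z = hamVF S (midpt z (φ z)) := by
  refine forall₂_congr fun z _ => ⟨fun hS => ?_, fun hS j => ?_⟩
  · ext (j | j)
    · rw [hamVF_inl, PiLp.sub_apply, (hS j).1, add_sub_cancel_left]
    · rw [hamVF_inr, PiLp.sub_apply, (hS j).2, sub_sub_cancel_left]
  · rw [← hamVF_inl, ← neg_eq_iff_eq_neg.2 (hamVF_inr S _ j), ← hS]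
    simp

theorem isMidpointStep_iff_sub_eq {f : PhaseSpace n → PhaseSpace n} {h : ℝ} {z z' : PhaseSpace n} :
    IsMidpointStep f h z z' ↔ z' - z = h • f (midpt z z') :=
  sub_eq_iff_eq_add'.symm

/-- The one-form `ω(φ z - z, ·)` in the midpoint coordinate `w`, where `z = ψ w`. When `ψ` is the
inverse of the midpoint chart, this is the one-form `α` on the graph of `φ`, expressed in that
chart. -/
noncomputable def midpointOneForm (φ ψ : PhaseSpace n → PhaseSpace n) (w : PhaseSpace n) :
    PhaseSpace n →L[ℝ] ℝ :=
  symplecticForm n (φ (ψ w) - ψ w)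

namespace IsMidpointChart

theorem congr (hc : IsMidpointChart k φ U V) (heq : EqOn φ' φ U) : IsMidpointChart k φ' U V := by
  have hmid : EqOn (fun z => midpt z (φ z)) (fun z => midpt z (φ' z)) U := fun z hz => by
    simp only [heq hz]
  obtain ⟨ψ, hinv, hψ⟩ := hc.contDiffOn_symm
  have hψU : MapsTo ψ V U := hinv.1.mapsTo hc.bijOn.surjOn
  exact ⟨hc.isOpen_source, hc.isOpen_target, hc.contDiffOn_map.congr heq, hc.bijOn.congr hmid, ψ,
    ⟨hinv.1.congr_right hmid, fun w hw => (hmid (hψU hw)).symm.trans (hinv.2 hw)⟩, hψ⟩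

theorem differentiableAt (hc : IsMidpointChart k φ U V) (hk : k ≠ 0) {z : PhaseSpace n}
    (hz : z ∈ U) : DifferentiableAt ℝ φ z :=
  (hc.contDiffOn_map.differentiableOn (by exact_mod_cast hk)).differentiableAt
    (hc.isOpen_source.mem_nhds hz)

theorem hasFDerivAt_midpt (hc : IsMidpointChart k φ U V) (hk : k ≠ 0) {z : PhaseSpace n}
    (hz : z ∈ U) : HasFDerivAt (fun w => midpt w (φ w))
      ((1 / 2 : ℝ) • (fderiv ℝ φ z + ContinuousLinearMap.id ℝ (PhaseSpace n))) z :=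
  ((hc.differentiableAt hk hz).hasFDerivAt.add (hasFDerivAt_id z)).const_smul (1 / 2 : ℝ)

theorem midpt_fderiv_symm (hc : IsMidpointChart k φ U V) (hk : k ≠ 0)
    (hinv : InvOn ψ (fun z => midpt z (φ z)) U V) (hψ : DifferentiableOn ℝ ψ V)
    {w : PhaseSpace n} (hw : w ∈ V) (a : PhaseSpace n) :
    midpt (fderiv ℝ ψ w a) (fderiv ℝ φ (ψ w) (fderiv ℝ ψ w a)) = a := by
  have hψw := (hψ.differentiableAt (hc.isOpen_target.mem_nhds hw)).hasFDerivAt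
  have hcomp := (hc.hasFDerivAt_midpt hk (hinv.1.mapsTo hc.bijOn.surjOn hw)).comp w hψw
  have hid := (hasFDerivAt_id (𝕜 := ℝ) w).congr_of_eventuallyEq
    (Filter.mem_of_superset (hc.isOpen_target.mem_nhds hw) fun _ hx => hinv.2 hx)
  exact congr($(hcomp.unique hid) a)

theorem exists_midpt_fderiv_eq (hc : IsMidpointChart k φ U V) (hk : k ≠ 0) {z : PhaseSpace n}
    (hz : z ∈ U) (a : PhaseSpace n) : ∃ b, midpt b (fderiv ℝ φ z b) = a := by
  obtain ⟨ψ, hinv, hψ⟩ := hc.contDiffOn_symm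
  have hψz := hc.midpt_fderiv_symm hk hinv (hψ.differentiableOn (by exact_mod_cast hk))
    (hc.bijOn.mapsTo hz) a
  rw [hinv.1 hz] at hψz
  exact ⟨_, hψz⟩

theorem isMidpointGeneratingFunction_iff (hc : IsMidpointChart k φ U V) (hk : k ≠ 0)
    {S : PhaseSpace n → ℝ} (hS : DifferentiableOn ℝ S V) :
    IsMidpointGeneratingFunction φ U S ↔ SatisfiesMidpointPDE φ U S := by
  rw [satisfiesMidpointPDE_iff]
  refine forall₂_congr fun z hz => ?_
  have hSz := (hS.differentiableAt (hc.isOpen_target.mem_nhds (hc.bijOn.mapsTo hz))).hasFDerivAt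
  have hcomp := hSz.comp z (hc.hasFDerivAt_midpt hk hz)
  have hα : (alphaForm (z, φ z)).comp
      ((ContinuousLinearMap.id ℝ (PhaseSpace n)).prod (fderiv ℝ φ z)) =
      (symplecticForm n (φ z - z)).comp
        ((1 / 2 : ℝ) • (fderiv ℝ φ z + ContinuousLinearMap.id ℝ (PhaseSpace n))) := by
    ext v
    exact alphaForm_apply _ _
  rw [eq_hamVF_iff, hα]
  refine ⟨fun hgen => ?_, fun hpde => hpde ▸ hcomp⟩
  -- The derivative of the midpoint map is onto, so it can be cancelled on the right.
  ext a
  obtain ⟨b, rfl⟩ := hc.exists_midpt_fderiv_eq hk hz a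
  exact congr($(hgen.unique hcomp) b)

theorem isInverseModifiedHamiltonian_iff (hc : IsMidpointChart k φ U V) {h : ℝ}
    {Hbar : PhaseSpace n → ℝ} (hH : DifferentiableOn ℝ Hbar V) :
    IsInverseModifiedHamiltonian φ h U Hbar ↔ SatisfiesMidpointPDE φ U (fun y => h * Hbar y) := by
  rw [satisfiesMidpointPDE_iff]
  refine forall₂_congr fun z hz => ?_
  rw [isMidpointStep_iff_sub_eq, hamVF_const_mul
    (hH.differentiableAt (hc.isOpen_target.mem_nhds (hc.bijOn.mapsTo hz)))]

theorem isMidpointStep_iff (hc : IsMidpointChart k φ U V) {h : ℝ} {Hbar : PhaseSpace n → ℝ}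
    (hH : IsInverseModifiedHamiltonian φ h U Hbar) {z z' : PhaseSpace n} (hm : midpt z z' ∈ V) :
    IsMidpointStep (hamVF Hbar) h z z' ↔ z ∈ U ∧ z' = φ z := by
  refine ⟨fun hstep => ?_, ?_⟩
  · obtain ⟨u, hu, humid : midpt u (φ u) = midpt z z'⟩ := hc.bijOn.surjOn hm
    have hdiff : φ u - u = z' - z := by
      rw [isMidpointStep_iff_sub_eq.1 (hH u hu), humid, isMidpointStep_iff_sub_eq.1 hstep]
    obtain ⟨rfl, hz'⟩ := eq_and_eq_of_midpt_eq_of_sub_eq humid hdiff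
    exact ⟨hu, hz'.symm⟩
  · rintro ⟨hz, rfl⟩
    exact hH z hz

theorem contDiffOn_midpointOneForm (hc : IsMidpointChart k φ U V) (hψU : MapsTo ψ V U)
    (hψ : ContDiffOn ℝ k ψ V) : ContDiffOn ℝ k (midpointOneForm φ ψ) V :=
  (symplecticForm n).contDiff.comp_contDiffOn ((hc.contDiffOn_map.comp hψ hψU).sub hψ)

theorem fderiv_midpointOneForm_symm (hc : IsMidpointChart k φ U V) (hk : k ≠ 0)
    (hsymp : IsSymplecticOn φ U) (hinv : InvOn ψ (fun z => midpt z (φ z)) U V)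
    (hψ : DifferentiableOn ℝ ψ V) {w : PhaseSpace n} (hw : w ∈ V) (a b : PhaseSpace n) :
    fderiv ℝ (midpointOneForm φ ψ) w a b = fderiv ℝ (midpointOneForm φ ψ) w b a := by
  have hψw : ψ w ∈ U := hinv.1.mapsTo hc.bijOn.surjOn hw
  have hdψ := (hψ.differentiableAt (hc.isOpen_target.mem_nhds hw)).hasFDerivAt
  have hdφ := (hc.differentiableAt hk hψw).hasFDerivAt
  have hform : HasFDerivAt (midpointOneForm φ ψ) ((symplecticForm n).comp
      ((fderiv ℝ φ (ψ w)).comp (fderiv ℝ ψ w) - fderiv ℝ ψ w)) w :=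
    (symplecticForm n).hasFDerivAt.comp w ((hdφ.comp w hdψ).sub hdψ)
  have hcayley := symplecticForm_sub_midpt_of_eq
    (hsymp _ hψw (fderiv ℝ ψ w a) (fderiv ℝ ψ w b))
  rw [hc.midpt_fderiv_symm hk hinv hψ hw, hc.midpt_fderiv_symm hk hinv hψ hw] at hcayley
  rw [hform.fderiv]
  exact hcayley

theorem exists_satisfiesMidpointPDE (hc : IsMidpointChart k φ U V) (hk : k ≠ 0)
    (hV : Convex ℝ V) (hsymp : IsSymplecticOn φ U) :
    ∃ S : PhaseSpace n → ℝ, ContDiffOn ℝ ((k + 1 : ℕ∞) : WithTop ℕ∞) S V ∧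
      SatisfiesMidpointPDE φ U S := by
  obtain ⟨ψ, hinv, hψ⟩ := hc.contDiffOn_symm
  have hk' : (k : WithTop ℕ∞) ≠ 0 := by exact_mod_cast hk
  have hform := hc.contDiffOn_midpointOneForm (hinv.1.mapsTo hc.bijOn.surjOn) hψ
  obtain ⟨S, hS⟩ := hV.exists_forall_hasFDerivAt_of_fderiv_symmetric hc.isOpen_target
    (hform.differentiableOn hk') fun w hw =>
      hc.fderiv_midpointOneForm_symm hk hsymp hinv (hψ.differentiableOn hk') hw
  refine ⟨S, ?_, satisfiesMidpointPDE_iff.2 fun z hz => ?_⟩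
  · push_cast
    exact (contDiffOn_succ_iff_fderiv_of_isOpen hc.isOpen_target).2
      ⟨fun w hw => (hS w hw).differentiableAt.differentiableWithinAt, by simp,
        hform.congr fun w hw => (hS w hw).fderiv⟩
  · rw [eq_hamVF_iff, (hS _ (hc.bijOn.mapsTo hz)).fderiv, midpointOneForm, hinv.1 hz]

end IsMidpointChart

end Chart

section Existence

open Filter Topology

variable {n : ℕ} {k : ℕ∞}

theorem isMidpointChart_slice {P : Type*} [NormedAddCommGroup P] [NormedSpace ℝ P]
    {Φ : P × PhaseSpace n → PhaseSpace n}
    {e : OpenPartialHomeomorph (P × PhaseSpace n) (P × PhaseSpace n)}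
    (he : ⇑e = fun x => (x.1, midpt x.2 (Φ x))) (hΦ : ContDiffOn ℝ k Φ e.source)
    (hsymm : ContDiffOn ℝ k e.symm e.target) {p : P} {V : Set (PhaseSpace n)} (hV : IsOpen V)
    (hpV : MapsTo (Prod.mk p) V e.target) :
    IsMidpointChart k (fun z => Φ (p, z)) {z | (p, z) ∈ e.source ∧ midpt z (Φ (p, z)) ∈ V} V := by
  have he_apply (x : P × PhaseSpace n) : e x = (x.1, midpt x.2 (Φ x)) := congrFun he x
  let ψ (w : PhaseSpace n) : PhaseSpace n := (e.symm (p, w)).2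
  have hψ_eq : ∀ w ∈ V, e.symm (p, w) = (p, ψ w) := fun w hw =>
    Prod.ext (congr($((he_apply _).symm.trans (e.right_inv (hpV hw))).1)) rfl
  have hinv : InvOn ψ (fun z => midpt z (Φ (p, z)))
      {z | (p, z) ∈ e.source ∧ midpt z (Φ (p, z)) ∈ V} V := by
    refine ⟨fun z hz => ?_, fun w hw => ?_⟩
    · simpa only [he_apply] using congrArg Prod.snd (e.left_inv hz.1)
    · simpa only [hψ_eq w hw, he_apply] using congrArg Prod.snd (e.right_inv (hpV hw))
  refine ⟨?_, hV, hΦ.comp (contDiff_prodMk_right p).contDiffOn fun z hz => hz.1,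
    hinv.bijOn (fun z hz => hz.2) fun w hw =>
      ⟨hψ_eq w hw ▸ e.map_target (hpV hw), mem_of_eq_of_mem (hinv.2 hw) hw⟩, ψ, hinv,
    contDiff_snd.comp_contDiffOn (hsymm.comp (contDiff_prodMk_right p).contDiffOn hpV)⟩
  have hopen := (e.isOpen_inter_preimage (hV.preimage continuous_snd)).preimage
    (Continuous.prodMk_right p)
  rwa [he] at hopen

theorem eventually_exists_isMidpointChart {P : Type*} [NormedAddCommGroup P] [NormedSpace ℝ P]
    [CompleteSpace P] (hk : k ≠ 0) {Φ : P × PhaseSpace n → PhaseSpace n}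
    {W : Set (P × PhaseSpace n)} (hW : IsOpen W) (hΦ : ContDiffOn ℝ k Φ W) {p₀ : P}
    (hid : ∀ z, (p₀, z) ∈ W → Φ (p₀, z) = z) {z₀ : PhaseSpace n} (hz₀ : (p₀, z₀) ∈ W) :
    ∀ᶠ x in 𝓝 (p₀, z₀), ∃ U V : Set (PhaseSpace n), x.2 ∈ U ∧ MapsTo (Prod.mk x.1) U W ∧
      Convex ℝ V ∧ IsMidpointChart k (fun z => Φ (x.1, z)) U V := by
  have hmid : ContDiffOn ℝ k (fun x : P × PhaseSpace n => midpt x.2 (Φ x)) W :=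
    (hΦ.add contDiff_snd.contDiffOn).const_smul (1 / 2 : ℝ)
  have hmid_id : ∀ z, (p₀, z) ∈ W → midpt z (Φ (p₀, z)) = z := fun z hz => by
    rw [hid z hz, midpt]
    module
  obtain ⟨e, he, hsource, heW, hsymm⟩ := exists_openPartialHomeomorph_prodMk_of_eq_id hmid hW
    (by exact_mod_cast hk) hz₀ hmid_id
  have htarget : e.target ∈ 𝓝 (p₀, z₀) := e.open_target.mem_nhds <| by
    simpa only [he, hmid_id z₀ hz₀] using e.map_source hsource
  obtain ⟨T, hT, A, hA, hTA⟩ := mem_nhds_prod_iff.1 htarget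
  obtain ⟨r, hr, hrA⟩ := Metric.mem_nhds_iff.1 hA
  have hball : ∀ᶠ x in 𝓝 (p₀, z₀), midpt x.2 (Φ x) ∈ Metric.ball z₀ r := by
    refine (hmid.continuousOn.continuousAt (hW.mem_nhds hz₀)).eventually_mem ?_
    rw [hmid_id z₀ hz₀]
    exact Metric.ball_mem_nhds z₀ hr
  filter_upwards [e.open_source.mem_nhds hsource, hball,
    continuous_fst.continuousAt.eventually_mem hT] with ⟨p, z⟩ hz hzr hpT
  exact ⟨{y | (p, y) ∈ e.source ∧ midpt y (Φ (p, y)) ∈ Metric.ball z₀ r}, Metric.ball z₀ r,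
    ⟨hz, hzr⟩, fun y hy => heW hy.1, convex_ball z₀ r,
    isMidpointChart_slice he (hΦ.mono heW) hsymm Metric.isOpen_ball
      fun w hw => hTA ⟨hpT, hrA hw⟩⟩

/-- Near `z` the time-`h` flow map of `f` is well defined and symplectic, and midpoint coordinates
are a `C^k` chart of its graph. The image of the chart is required to be convex, so that closed
one-forms on it are exact. -/
def HasSymplecticMidpointChart (k : ℕ∞) (f : PhaseSpace n → PhaseSpace n) (h : ℝ)
    (z : PhaseSpace n) : Prop :=
  ∃ U V : Set (PhaseSpace n), z ∈ U ∧ FlowDefinedOn f h U ∧ IsMidpointChart k (flowMap f h) U V ∧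
    Convex ℝ V ∧ IsSymplecticOn (flowMap f h) U

theorem eventually_hasSymplecticMidpointChart (hk : k ≠ 0) {H : PhaseSpace n → ℝ}
    (hH : ContDiff ℝ ((k + 1 : ℕ∞) : WithTop ℕ∞) H) (z₀ : PhaseSpace n) :
    ∀ᶠ x : ℝ × PhaseSpace n in 𝓝 (0, z₀),
      0 < x.1 → HasSymplecticMidpointChart k (hamVF H) x.1 x.2 := by
  have hk₁ : (1 : WithTop ℕ∞) ≤ k := by exact_mod_cast Order.one_le_iff_ne_zero.2 hk
  have hf : ContDiff ℝ k (hamVF H) := contDiff_hamVF hH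
  have hlip : LocallyLipschitz (hamVF H) := (hf.of_le hk₁).locallyLipschitz
  have hH₂ : ContDiff ℝ 2 H := hH.of_le <| by
    push_cast
    rw [← one_add_one_eq_two]
    gcongr
  obtain ⟨W, hW, hz₀, Φ, hΦ, hΦ₀, hflow, hpres⟩ :=
    exists_contDiffOn_flow hk hf (symplecticForm_fderiv_hamVF_skew hH₂) z₀
  filter_upwards [eventually_exists_isMidpointChart hk hW hΦ hΦ₀ hz₀] with ⟨h, z⟩ hchart hh
  obtain ⟨U, V, hzU, hUW, hV, hc⟩ := hchart
  have heq : EqOn (flowMap (hamVF H) h) (fun w => Φ (h, w)) U := fun w hw =>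
    (hflow h w (hUW hw) hh).flowMap_eq hlip hh.le
  have hsymp : IsSymplecticOn (fun w => Φ (h, w)) U := fun w hw => hpres h w (hUW hw)
  exact ⟨U, V, hzU, flowDefinedOn_of_forall_flowsTo hlip hh.le
      fun w hw => ⟨_, hflow h w (hUW hw) hh⟩,
    hc.congr heq, hV, hsymp.congr hc.isOpen_source heq⟩

theorem exists_forall_hasSymplecticMidpointChart (hk : k ≠ 0) {H : PhaseSpace n → ℝ}
    (hH : ContDiff ℝ ((k + 1 : ℕ∞) : WithTop ℕ∞) H) {K : Set (PhaseSpace n)} (hK : IsCompact K) :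
    ∃ h₀ : ℝ, 0 < h₀ ∧ ∀ h : ℝ, 0 < h → h < h₀ → ∀ z ∈ K,
      HasSymplecticMidpointChart k (hamVF H) h z := by
  obtain ⟨h₀, hpos, hsmall⟩ := Metric.eventually_nhds_iff.1 <|
    hK.eventually_forall_of_forall_eventually
      (P := fun h z => 0 < h → HasSymplecticMidpointChart k (hamVF H) h z)
      fun z _ => eventually_hasSymplecticMidpointChart hk hH z
  exact ⟨h₀, hpos, fun h hh hlt z hz => hsmall (by simpa [abs_of_pos hh] using hlt) z hz hh⟩

end Existence

theorem mainTheorem1 (n : ℕ) (k : ℕ∞) (hk : 1 ≤ k) (H : PhaseSpace n → ℝ)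
    (hH : ContDiff ℝ ((k + 1 : ℕ∞) : WithTop ℕ∞) H)
    (K : Set (PhaseSpace n)) (hK : IsCompact K) :
    ∃ h₀ : ℝ, 0 < h₀ ∧ ∀ h : ℝ, 0 < h → h < h₀ → ∀ z₀ ∈ K,
      ∃ U V : Set (PhaseSpace n), z₀ ∈ U ∧
        -- the exact flow map exists near `z₀`, and midpoint coordinates are a chart of its graph
        FlowDefinedOn (hamVF H) h U ∧
        IsMidpointChart k (flowMap (hamVF H) h) U V ∧
        -- a generating function exists
        (∃ S : PhaseSpace n → ℝ, ContDiffOn ℝ ((k + 1 : ℕ∞) : WithTop ℕ∞) S V ∧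
          IsMidpointGeneratingFunction (flowMap (hamVF H) h) U S) ∧
        -- generating functions are the solutions of the partial differential equations
        (∀ S : PhaseSpace n → ℝ, DifferentiableOn ℝ S V →
          (IsMidpointGeneratingFunction (flowMap (hamVF H) h) U S ↔
            SatisfiesMidpointPDE (flowMap (hamVF H) h) U S)) ∧
        -- `Hbar` is an inverse modified Hamiltonian iff `h * Hbar` solves the same equations;
        -- the midpoint rule applied to it is then the exact flow, and nothing else
        (∀ Hbar : PhaseSpace n → ℝ, DifferentiableOn ℝ Hbar V →
          (IsInverseModifiedHamiltonian (flowMap (hamVF H) h) h U Hbar ↔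
            SatisfiesMidpointPDE (flowMap (hamVF H) h) U (fun y => h * Hbar y)) ∧
          (IsInverseModifiedHamiltonian (flowMap (hamVF H) h) h U Hbar →
            ∀ z z' : PhaseSpace n, midpt z z' ∈ V →
              (IsMidpointStep (hamVF Hbar) h z z' ↔ z ∈ U ∧ z' = flowMap (hamVF H) h z))) ∧
        -- an inverse modified Hamiltonian exists
        (∃ Hbar : PhaseSpace n → ℝ, ContDiffOn ℝ ((k + 1 : ℕ∞) : WithTop ℕ∞) Hbar V ∧
          IsInverseModifiedHamiltonian (flowMap (hamVF H) h) h U Hbar) := by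
  have hk₀ : k ≠ 0 := Order.one_le_iff_ne_zero.1 hk
  obtain ⟨h₀, hpos, hsmall⟩ := exists_forall_hasSymplecticMidpointChart hk₀ hH hK
  refine ⟨h₀, hpos, fun h hh hlt z₀ hz₀ => ?_⟩
  obtain ⟨U, V, hzU, hflow, hchart, hV, hsymp⟩ := hsmall h hh hlt z₀ hz₀
  obtain ⟨S, hS, hpde⟩ := hchart.exists_satisfiesMidpointPDE hk₀ hV hsymp
  have hSd : DifferentiableOn ℝ S V := hS.differentiableOn (by simp)
  have hHbar : ContDiffOn ℝ ((k + 1 : ℕ∞) : WithTop ℕ∞) (fun y => h⁻¹ * S y) V :=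
    contDiffOn_const.mul hS
  refine ⟨U, V, hzU, hflow, hchart,
    ⟨S, hS, (hchart.isMidpointGeneratingFunction_iff hk₀ hSd).2 hpde⟩,
    fun S' hS' => hchart.isMidpointGeneratingFunction_iff hk₀ hS',
    fun Hbar hHd => ⟨hchart.isInverseModifiedHamiltonian_iff hHd,
      fun hinv z z' hm => hchart.isMidpointStep_iff hinv hm⟩,
    fun y => h⁻¹ * S y, hHbar, ?_⟩
  rw [hchart.isInverseModifiedHamiltonian_iff (hHbar.differentiableOn (by simp))]
  simpa only [mul_inv_cancel_left₀ hh.ne'] using hpde
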